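/- A map $f:X\to Y$ between metric spaces is a \emph{uniform quotient mapping} if there exist nondecreasing functions $\omega,\Omega:[0,\infty)\to[0,\infty)$ with $\omega(r)>0$ for $r>0$ and $\Omega(r)\to 0$ as $r\to 0$, such that for all $x\in X$ and $r>0$, $$B(f(x),\omega(r))\subseteq f(B(x,r))\subseteq B(f(x),\Omega(r)),$$ where $B(\cdot,\cdot)$ denotes closed balls. If such an $f$ can be chosen surjective, then $Y$ is called a \emph{uniform quotient} of $X$. A norm $\|\cdot\|$ on a Banach space $X$ has \emph{property $(\beta)$} of Rolewicz if there is a number $a\in[1,2]$ such that for every $t\in(0,a]$ there exists $\delta>0$ with the following property: for every $x\in X$ and every sequence $(x_n)_{n\ge 1}$ in $X$ with $\|x\|\le 1$, $\|x_n\|\le 1$ for all $n$, and $\inf\{\|x_n-x_m\|: n\ne m\}\ge t$, there is an $n\ge 1$ with $\frac{\|x-x_n\|}{2}\le 1-\delta$. \textbf{Theorem.} Let $X$ and $Y$ be (real or complex) Banach spaces such that $Y$ is a uniform quotient of $X$. If $X$ has an equivalent norm with property $(\beta)$, then $Y$ is reflexive. -/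

import Mathlib

open Filter Topology
open scoped NNReal

/-- A uniform quotient mapping between metric spaces: there are nondecreasing functions
`ω, Ω : [0, ∞) → [0, ∞)` with `ω r > 0` for `r > 0` and `Ω r → 0` as `r → 0` such that
`B (f x, ω r) ⊆ f (B (x, r)) ⊆ B (f x, Ω r)` for all `x` and all `r > 0` (closed balls). -/
def IsUniformQuotientMap {X Y : Type*} [MetricSpace X] [MetricSpace Y] (f : X → Y) : Prop :=
  ∃ ω Ω : ℝ≥0 → ℝ≥0, Monotone ω ∧ Monotone Ω ∧ (∀ r, 0 < r → 0 < ω r) ∧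
    Tendsto Ω (𝓝[>] 0) (𝓝 0) ∧
    ∀ (x : X) (r : ℝ≥0), 0 < r →
      Metric.closedBall (f x) (ω r) ⊆ f '' Metric.closedBall x r ∧
      f '' Metric.closedBall x r ⊆ Metric.closedBall (f x) (Ω r)

/-- The metric space `Y` is a uniform quotient of the metric space `X`. -/
def IsUniformQuotient (X Y : Type*) [MetricSpace X] [MetricSpace Y] : Prop :=
  ∃ f : X → Y, Function.Surjective f ∧ IsUniformQuotientMap f

/-- `N` is a norm on the normed space `X` that is equivalent to the given one. -/
def IsEquivalentNorm {𝕜 X : Type*} [RCLike 𝕜] [NormedAddCommGroup X] [NormedSpace 𝕜 X]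
    (N : Seminorm 𝕜 X) : Prop :=
  ∃ c C : ℝ, 0 < c ∧ 0 < C ∧ ∀ x : X, c * ‖x‖ ≤ N x ∧ N x ≤ C * ‖x‖

/-- Property (β) of Rolewicz for the norm `N` (in Kutzarova's form): there is `a ∈ [1, 2]` such
that for all `t ∈ (0, a]` there is `δ > 0` such that for every `x` and every sequence `u` in the
closed unit ball of `N` with `inf {N (u n - u m) : n ≠ m} ≥ t` there is `n` with
`N (x - u n) / 2 ≤ 1 - δ`. -/
def HasPropertyBeta {𝕜 X : Type*} [RCLike 𝕜] [NormedAddCommGroup X] [NormedSpace 𝕜 X]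
    (N : Seminorm 𝕜 X) : Prop :=
  ∃ a : ℝ, 1 ≤ a ∧ a ≤ 2 ∧ ∀ t : ℝ, 0 < t → t ≤ a → ∃ δ : ℝ, 0 < δ ∧
    ∀ (x : X) (u : ℕ → X), N x ≤ 1 → (∀ n, N (u n) ≤ 1) →
      (∀ n m, n ≠ m → t ≤ N (u n - u m)) → ∃ n, N (x - u n) / 2 ≤ 1 - δ

/-- `X` has an equivalent norm with property (β). -/
def HasEquivalentBetaNorm (𝕜 X : Type*) [RCLike 𝕜] [NormedAddCommGroup X]
    [NormedSpace 𝕜 X] : Prop :=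
  ∃ N : Seminorm 𝕜 X, IsEquivalentNorm N ∧ HasPropertyBeta N

/-- Reflexivity: the canonical embedding into the bidual is onto. -/
def IsReflexiveSpace (𝕜 Y : Type*) [RCLike 𝕜] [NormedAddCommGroup Y]
    [NormedSpace 𝕜 Y] : Prop :=
  Function.Surjective (NormedSpace.inclusionInDoubleDual 𝕜 Y)

/-! ### Sequences in a non-reflexive space -/

section Dual

variable {𝕜 E : Type*} [RCLike 𝕜] [NormedAddCommGroup E] [NormedSpace 𝕜 E]

/-! If `Y` is not reflexive, James' sequences make the sum over a late block of indices differ from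
the sum over any earlier block by a fixed multiple of the late block's length
(`mul_length_le_norm_sum_sub_sum`). The quotient map lifts these sums to paths of bounded steps in
`X`; being Lipschitz at large distances, it keeps the endpoints of lifted blocks linearly separated.

Property (β) forbids this (`HasPropertyBeta.not_forall_precedes_separated`). The continuations of a
path are infinitely many separated points, so some continuation ends at most `2qρ` from the start,
with `q < 1`, where each half moves by at most `ρ`. Repeated doubling makes typical displacement
sublinear in length, against linear separation. -/

theorem RCLike.exists_norm_eq_one_mul_eq_norm (z : 𝕜) : ∃ c : 𝕜, ‖c‖ = 1 ∧ c * z = (‖z‖ : 𝕜) := by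
  obtain ⟨c, hc, h⟩ := RCLike.exists_norm_mul_eq_self z
  refine ⟨starRingEnd 𝕜 c, by simpa using hc, ?_⟩
  conv_lhs => rw [← h]
  rw [← mul_assoc, RCLike.conj_mul, hc]
  simp

theorem StrongDual.mul_norm_le_of_forall_re_le (φ : StrongDual 𝕜 E) {r u : ℝ} (hr : 0 ≤ r)
    (h : ∀ y, ‖y‖ ≤ r → RCLike.re (φ y) ≤ u) : r * ‖φ‖ ≤ u := by
  have hu : 0 ≤ u := by simpa using h 0 (by simpa using hr)
  by_contra! hlt
  rcases hr.eq_or_lt with rfl | hr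
  · simp at hlt; linarith
  have hlt' : u / r < ‖φ‖ := by rwa [div_lt_iff₀ hr, mul_comm]
  obtain ⟨x, hx, hφ⟩ := φ.exists_lt_apply_of_lt_opNorm hlt'
  obtain ⟨c, hc, hcx⟩ := RCLike.exists_norm_eq_one_mul_eq_norm (φ x)
  have := h ((r : 𝕜) • c • x) (by
    rw [norm_smul, norm_smul, hc, RCLike.norm_ofReal, abs_of_pos hr]
    nlinarith)
  rw [φ.map_smul, φ.map_smul, smul_eq_mul, smul_eq_mul, hcx, ← RCLike.ofReal_mul,
    RCLike.ofReal_re] at this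
  rw [div_lt_iff₀ hr] at hφ
  linarith

/-- Helly's lemma: on finitely many functionals, an element of the bidual is approximated by
vectors of no larger norm. -/
theorem StrongDual.exists_norm_le_forall_norm_sub_lt (F : StrongDual 𝕜 (StrongDual 𝕜 E))
    (s : Finset (StrongDual 𝕜 E)) {ε : ℝ} (hε : 0 < ε) :
    ∃ y : E, ‖y‖ ≤ ‖F‖ ∧ ∀ φ ∈ s, ‖φ y - F φ‖ < ε := by
  classical
  let T : E →L[𝕜] (s → 𝕜) := ContinuousLinearMap.pi fun φ => (φ : StrongDual 𝕜 E)
  let v : s → 𝕜 := fun φ => F φ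
  let _ : NormedSpace ℝ E := NormedSpace.restrictScalars ℝ 𝕜 E
  have : IsScalarTower ℝ 𝕜 E := IsScalarTower.of_algebraMap_smul fun _ _ => rfl
  have hconv : Convex ℝ (T '' Metric.closedBall 0 ‖F‖) :=
    (convex_closedBall (0 : E) ‖F‖).linear_image ((T : E →ₗ[𝕜] (s → 𝕜)).restrictScalars ℝ)
  by_cases hv : v ∈ closure (T '' Metric.closedBall 0 ‖F‖)
  · obtain ⟨_, ⟨y, hy, rfl⟩, hd⟩ := Metric.mem_closure_iff.1 hv ε hε
    refine ⟨y, by simpa using hy, fun φ hφ => ?_⟩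
    rw [dist_comm, dist_eq_norm] at hd
    exact (norm_le_pi_norm (T y - v) ⟨φ, hφ⟩).trans_lt hd
  · exfalso
    obtain ⟨g, u, hg, hu⟩ :=
      RCLike.geometric_hahn_banach_closed_point (𝕜 := 𝕜) hconv.closure isClosed_closure hv
    have hsum : ∀ w : s → 𝕜, g w = ∑ i, g (Pi.single i 1) * w i := fun w => by
      conv_lhs => rw [pi_eq_sum_univ' w]
      simp [mul_comm]
    have hF : F (g.comp T) = g v := by
      have : g.comp T = ∑ i : s, g (Pi.single i 1) • (i : StrongDual 𝕜 E) := by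
        ext y
        rw [ContinuousLinearMap.comp_apply, hsum]
        simp [T]
      rw [this, hsum v]
      simp [v]
    -- Separation would give `‖F‖ * ‖g ∘ T‖ ≤ u < re (F (g ∘ T))`.
    have h1 := StrongDual.mul_norm_le_of_forall_re_le (g.comp T) (norm_nonneg F) (u := u)
      fun y hy => (hg _ (subset_closure ⟨y, by simpa using hy, rfl⟩)).le
    have h2 := F.le_opNorm (g.comp T)
    have h3 := RCLike.re_le_norm (F (g.comp T))
    rw [hF] at h2 h3
    linarith

/-- If all combinations of `L` are at distance more than `d` from the functional `F`, then `F` is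
at least `d` at some point of the unit ball where all of `L` vanishes. -/
theorem StrongDual.exists_norm_le_one_forall_eq_zero {ι : Type*} [Fintype ι] (F : StrongDual 𝕜 E)
    (L : ι → StrongDual 𝕜 E) {d : ℝ} (h : ∀ a : ι → 𝕜, d < ‖F - ∑ i, a i • L i‖) :
    ∃ x : E, ‖x‖ ≤ 1 ∧ (∀ i, L i x = 0) ∧ d ≤ RCLike.re (F x) := by
  let p : Submodule 𝕜 E := ⨅ i, LinearMap.ker (L i).toLinearMap
  obtain ⟨G, hG, hn⟩ := exists_extension_norm_eq p (F.comp p.subtypeL)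
  -- `F - G` vanishes on the common kernel, so `G` is `F` minus a combination of `L`, and `‖G‖` is
  -- the norm of `F` restricted to that kernel.
  have hmem : (F - G).toLinearMap ∈
      Submodule.span 𝕜 (Set.range fun i => (L i).toLinearMap) := by
    apply mem_span_of_iInf_ker_le_ker
    intro x hx
    have h : G x = F x := hG ⟨x, hx⟩
    simp [h]
  obtain ⟨a, ha⟩ := (Submodule.mem_span_range_iff_exists_fun 𝕜).1 hmem
  have hG' : G = F - ∑ i, a i • L i := by
    ext x
    have h1 := LinearMap.congr_fun ha x
    rw [LinearMap.sum_apply] at h1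
    have h2 : ∑ i, a i • L i x = F x - G x := h1
    have h3 : (∑ i, a i • L i) x = F x - G x := by rw [← h2]; simp
    rw [sub_apply, h3, sub_sub_cancel]
  have hlt : d < ‖F.comp p.subtypeL‖ := by
    rw [← hn, hG']
    exact h a
  obtain ⟨x, hx, hFx⟩ := ContinuousLinearMap.exists_lt_apply_of_lt_opNorm _ hlt
  obtain ⟨c, hc, hcx⟩ := RCLike.exists_norm_eq_one_mul_eq_norm (F x)
  refine ⟨c • (x : E), ?_, fun i => ?_, ?_⟩
  · rw [norm_smul, hc, one_mul]
    exact hx.le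
  · have h0 : L i x = 0 := (Submodule.mem_iInf _).1 x.2 i
    simp [h0]
  · rw [map_smul, smul_eq_mul, hcx, RCLike.ofReal_re]
    exact hFx.le

theorem Isometry.exists_pos_forall_le_norm_sub {V W : Type*} [NormedAddCommGroup V]
    [NormedAddCommGroup W] [CompleteSpace V] {J : V → W} (hJ : Isometry J) {w : W}
    (hw : w ∉ Set.range J) : ∃ d, 0 < d ∧ ∀ v, d ≤ ‖w - J v‖ := by
  obtain ⟨d, hd, hball⟩ := Metric.isOpen_iff.1 hJ.isClosedEmbedding.isClosed_range.isOpen_compl w hw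
  refine ⟨d, hd, fun v => ?_⟩
  by_contra! hlt
  exact hball (by rwa [Metric.mem_ball', dist_eq_norm]) ⟨v, rfl⟩

/-- James' sequences in a non-reflexive Banach space. -/
theorem exists_seq_of_not_isReflexiveSpace [CompleteSpace E] (h : ¬ IsReflexiveSpace 𝕜 E) :
    ∃ (θ C : ℝ) (y : ℕ → E) (φ : ℕ → StrongDual 𝕜 E), 0 < θ ∧ 0 < C ∧ (∀ n, ‖y n‖ ≤ C) ∧
      (∀ n, ‖φ n‖ ≤ 1) ∧ (∀ m n, m < n → φ n (y m) = 0) ∧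
      ∀ m n, m ≤ n → θ ≤ RCLike.re (φ m (y n)) := by
  classical
  obtain ⟨F, hF⟩ := not_forall.1 h
  obtain ⟨d, hd, hdist⟩ :=
    (NormedSpace.inclusionInDoubleDualLi (E := E) 𝕜).isometry.exists_pos_forall_le_norm_sub hF
  -- Greedy choice. Keeping `F` at least `d / 2` on every chosen functional lets each later vector,
  -- which imitates `F` up to `d / 4`, stay at least `d / 4` on all of them.
  obtain ⟨p, hp, hr⟩ := exists_seq_of_forall_finset_exists
    (fun p : StrongDual 𝕜 E × E => ‖p.1‖ ≤ 1 ∧ ‖p.2‖ ≤ ‖F‖ ∧ d / 4 ≤ RCLike.re (p.1 p.2) ∧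
      d / 2 ≤ RCLike.re (F p.1))
    (fun p q => q.1 p.2 = 0 ∧ d / 4 ≤ RCLike.re (p.1 q.2)) (fun s hs => by
      obtain ⟨φ, hφ, hφ0, hφF⟩ := StrongDual.exists_norm_le_one_forall_eq_zero F
        (fun q : s => NormedSpace.inclusionInDoubleDual 𝕜 E q.1.2) (d := d / 2) fun a => by
          have h1 := hdist (∑ q, a q • q.1.2)
          have h2 : NormedSpace.inclusionInDoubleDual 𝕜 E (∑ q, a q • q.1.2) =
              ∑ q, a q • NormedSpace.inclusionInDoubleDual 𝕜 E q.1.2 := by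
            simp only [map_sum, map_smul]
          rw [h2] at h1
          linarith
      obtain ⟨y, hy, hyF⟩ := StrongDual.exists_norm_le_forall_norm_sub_lt F
        (insert φ (s.image Prod.fst)) (show 0 < d / 4 by linarith)
      have key : ∀ ψ ∈ insert φ (s.image Prod.fst), d / 2 ≤ RCLike.re (F ψ) →
          d / 4 ≤ RCLike.re (ψ y) := fun ψ hψ hd' => by
        have h1 := (abs_le.1 ((RCLike.abs_re_le_norm _).trans (hyF ψ hψ).le)).1
        rw [map_sub] at h1
        linarith
      refine ⟨(φ, y), ⟨hφ, hy, key φ (by simp) hφF, hφF⟩, fun q hq => ⟨?_, ?_⟩⟩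
      · exact hφ0 ⟨q, hq⟩
      · exact key _ (Finset.mem_insert_of_mem (Finset.mem_image_of_mem _ hq)) (hs q hq).2.2.2)
  refine ⟨d / 4, ‖F‖ + 1, fun n => (p n).2, fun n => (p n).1, by linarith, by positivity,
    fun n => by linarith [(hp n).2.1], fun n => (hp n).1, fun m n hmn => (hr m n hmn).1,
    fun m n hmn => ?_⟩
  rcases hmn.eq_or_lt with rfl | hmn
  · exact (hp m).2.2.1
  · exact (hr m n hmn).2

end Dual

/-! ### Iterated limits along lists of natural numbers -/

/-- The filter on lists of length `k` given by `k` nested quantifiers "for all large `n`". -/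
def listFilter : ℕ → Filter (List ℕ)
  | 0 => pure []
  | k + 1 => (atTop : Filter ℕ).bind fun n => (listFilter k).map (List.cons n)

theorem eventually_listFilter_succ {k : ℕ} {P : List ℕ → Prop} :
    (∀ᶠ b in listFilter (k + 1), P b) ↔ ∀ᶠ n in atTop, ∀ᶠ b in listFilter k, P (n :: b) := by
  simp [listFilter, Filter.eventually_bind]

theorem eventually_listFilter_add {k l : ℕ} {P : List ℕ → Prop} :
    (∀ᶠ b in listFilter (k + l), P b) ↔
      ∀ᶠ a in listFilter k, ∀ᶠ b in listFilter l, P (a ++ b) := by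
  induction k generalizing P with
  | zero => simp [listFilter]
  | succ k ih =>
    rw [Nat.add_right_comm, eventually_listFilter_succ, eventually_listFilter_succ]
    simp only [ih, List.cons_append]

instance listFilter_neBot (k : ℕ) : (listFilter k).NeBot := by
  induction k with
  | zero => exact Filter.pure_neBot
  | succ k ih =>
    rw [Filter.neBot_iff, Ne, ← Filter.eventually_false_iff_eq_bot, eventually_listFilter_succ]
    simpa using fun n => ⟨⟨n, le_rfl⟩, ih.ne⟩

theorem eventually_length_listFilter (k : ℕ) : ∀ᶠ b in listFilter k, b.length = k := by
  induction k with
  | zero => simp [listFilter]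
  | succ k ih =>
    rw [eventually_listFilter_succ]
    exact .of_forall fun n => ih.mono fun b hb => by simp [hb]

theorem eventually_forall_le_listFilter (k m : ℕ) : ∀ᶠ b in listFilter k, ∀ n ∈ b, m ≤ n := by
  induction k with
  | zero => simp [listFilter]
  | succ k ih =>
    rw [eventually_listFilter_succ]
    filter_upwards [eventually_ge_atTop m] with n hn
    exact ih.mono fun b hb => by simpa using ⟨hn, hb⟩

/-- Some threshold separates the entries of `b` from those of `b'`. -/
def List.Precedes (b b' : List ℕ) : Prop :=
  ∃ m, (∀ n ∈ b, n < m) ∧ ∀ n ∈ b', m ≤ n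

theorem exists_forall_lt_of_finset_list (s : Finset (List ℕ)) : ∃ m, ∀ b ∈ s, ∀ n ∈ b, n < m := by
  refine ⟨(s.sup List.sum) + 1, fun b hb n hn => Nat.lt_succ_of_le ?_⟩
  exact (List.single_le_sum (fun _ _ => Nat.zero_le _) n hn).trans (Finset.le_sup hb)

theorem exists_precedes_seq {k : ℕ} {P : List ℕ → Prop} (h : ∃ᶠ b in listFilter k, P b) :
    ∃ b : ℕ → List ℕ, (∀ i, P (b i) ∧ (b i).length = k) ∧
      ∀ i j, i < j → (b i).Precedes (b j) := by
  refine exists_seq_of_forall_finset_exists (fun b => P b ∧ b.length = k) List.Precedes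
    fun s _ => ?_
  obtain ⟨m, hm⟩ := exists_forall_lt_of_finset_list s
  obtain ⟨b, hb, hl, hbm⟩ := (h.and_eventually ((eventually_length_listFilter k).and
    (eventually_forall_le_listFilter k m))).exists
  exact ⟨b, ⟨hb, hl⟩, fun a ha => ⟨m, hm a ha, hbm⟩⟩

/-! ### Branching paths under property (β) -/

section Paths

variable {𝕜 X : Type*} [RCLike 𝕜] [NormedAddCommGroup X] [NormedSpace 𝕜 X]

/-- Property (β) translated to centre `z` and rescaled; the point is that `q` does not depend on
`ρ`. -/
theorem HasPropertyBeta.exists_fork {N : Seminorm 𝕜 X} (hN : HasPropertyBeta N) {t : ℝ}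
    (ht : 0 < t) : ∃ q : ℝ, 0 ≤ q ∧ q < 1 ∧ ∀ ρ : ℝ, 0 < ρ → ∀ (x z : X) (u : ℕ → X),
      N (x - z) ≤ ρ → (∀ n, N (u n - z) ≤ ρ) →
      (∀ n m, n ≠ m → t * ρ ≤ N (u n - u m)) → ∃ n, N (x - u n) ≤ 2 * q * ρ := by
  obtain ⟨a, ha, -, h⟩ := hN
  obtain ⟨δ, hδ, h⟩ := h (min t 1) (by positivity) ((min_le_right _ _).trans ha)
  -- Capping `δ` at 1 keeps `q` nonnegative.
  refine ⟨1 - min δ 1, by linarith [min_le_right δ 1],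
    by linarith [lt_min hδ one_pos], fun ρ hρ x z u hx hu hsep => ?_⟩
  have hscale : ∀ w, N (((ρ⁻¹ : ℝ) : 𝕜) • w) = N w / ρ := fun w => by
    rw [map_smul_eq_mul, RCLike.norm_ofReal, abs_of_pos (inv_pos.2 hρ)]
    ring
  obtain ⟨n, hn⟩ := h (((ρ⁻¹ : ℝ) : 𝕜) • (x - z)) (fun n => ((ρ⁻¹ : ℝ) : 𝕜) • (u n - z))
    (by rw [hscale, div_le_one hρ]; exact hx) (fun n => by rw [hscale, div_le_one hρ]; exact hu n)
    (fun n m hnm => by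
      rw [← smul_sub, sub_sub_sub_cancel_right, hscale, le_div_iff₀ hρ]
      exact (mul_le_mul_of_nonneg_right (min_le_left _ _) hρ.le).trans (hsep n m hnm))
  refine ⟨n, ?_⟩
  rw [← smul_sub, sub_sub_sub_cancel_right, hscale] at hn
  have : N (x - u n) / ρ ≤ 2 * (1 - min δ 1) := by linarith [min_le_left δ 1]
  rwa [div_le_iff₀ hρ] at this

theorem eventually_foldl_double {N : Seminorm 𝕜 X} {step : X → ℕ → X} {c t q ρ : ℝ} {m k : ℕ}
    (hfork : ∀ (x z : X) (u : ℕ → X), N (x - z) ≤ ρ → (∀ n, N (u n - z) ≤ ρ) →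
      (∀ n m, n ≠ m → t * ρ ≤ N (u n - u m)) → ∃ n, N (x - u n) ≤ 2 * q * ρ)
    (hsep : ∀ (x : X) (b b' : List ℕ), m ≤ b'.length → b.Precedes b' →
      c * b'.length ≤ N (b.foldl step x - b'.foldl step x))
    (hmk : m ≤ k) (htρ : t * ρ ≤ c * k)
    (h : ∀ x, ∀ᶠ b in listFilter k, N (x - b.foldl step x) ≤ ρ) (x : X) :
    ∀ᶠ b in listFilter (k + k), N (x - b.foldl step x) ≤ 2 * q * ρ := by
  rw [eventually_listFilter_add]
  filter_upwards [h x] with a ha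
  -- Frequent failure yields infinitely many successive bad continuations; their endpoints are
  -- separated, so the fork property makes one of them good.
  by_contra hbad
  obtain ⟨b, hb, hlt⟩ := exists_precedes_seq
    ((not_eventually.1 hbad).and_eventually (h (a.foldl step x)))
  have hlt' : ∀ i j, i < j →
      t * ρ ≤ N ((b i).foldl step (a.foldl step x) - (b j).foldl step (a.foldl step x)) :=
    fun i j hij => by
      have := hsep (a.foldl step x) _ _ (hmk.trans_eq (hb j).2.symm) (hlt i j hij)
      rw [(hb j).2] at this
      exact htρ.trans this
  obtain ⟨n, hn⟩ := hfork x (a.foldl step x) (fun i => (b i).foldl step (a.foldl step x)) ha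
    (fun i => by rw [map_sub_rev]; exact (hb i).1.2) (fun i j hij => by
      rcases hij.lt_or_gt with hij | hij
      · exact hlt' i j hij
      · rw [map_sub_rev]; exact hlt' j i hij)
  exact (hb n).1.1 (by rwa [List.foldl_append])

theorem HasPropertyBeta.not_forall_precedes_separated {N : Seminorm 𝕜 X} (hN : HasPropertyBeta N)
    {step : X → ℕ → X} {A c : ℝ} {m : ℕ} (hA : 0 < A) (hc : 0 < c) (hm : 0 < m)
    (hstep : ∀ x n, N (x - step x n) ≤ A) :
    ¬ ∀ (x : X) (b b' : List ℕ), m ≤ b'.length → b.Precedes b' →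
      c * b'.length ≤ N (b.foldl step x - b'.foldl step x) := by
  intro hsep
  have hcA : 0 < c / A := by positivity
  have hm' : (0 : ℝ) < m := by exact_mod_cast hm
  obtain ⟨q, hq0, hq1, hfork⟩ := hN.exists_fork hcA
  -- `q` may be 0, but the radii below must be positive.
  have hr : ∃ r : ℝ, q ≤ r ∧ 0 < r ∧ r < 1 := ⟨(q + 1) / 2, by linarith, by linarith, by linarith⟩
  obtain ⟨r, hqr, hr0, hr1⟩ := hr
  have hpath : ∀ (b : List ℕ) (x : X), N (x - b.foldl step x) ≤ A * b.length := by
    intro b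
    induction b with
    | nil => intro x; simp
    | cons n b ih =>
      intro x
      have h1 := map_add_le_add N (x - step x n) (step x n - b.foldl step (step x n))
      rw [sub_add_sub_cancel] at h1
      have h2 := ih (step x n)
      have h3 := hstep x n
      simp only [List.foldl_cons, List.length_cons]
      push_cast
      linarith
  have hmain : ∀ (i : ℕ) (x : X), ∀ᶠ b in listFilter (2 ^ i * m),
      N (x - b.foldl step x) ≤ A * m * (2 * r) ^ i := by
    intro i
    induction i with
    | zero =>
      intro x
      filter_upwards [eventually_length_listFilter (2 ^ 0 * m)] with b hb
      simpa [hb] using hpath b x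
    | succ i ih =>
      have hρ : 0 < A * m * (2 * r) ^ i := by positivity
      have hk : 2 ^ (i + 1) * m = 2 ^ i * m + 2 ^ i * m := by ring
      have hpow : r ^ i ≤ 1 := pow_le_one₀ hr0.le hr1.le
      intro x
      rw [hk]
      refine (eventually_foldl_double (hfork _ hρ) hsep ?_ ?_ ih x).mono fun b hb => hb.trans ?_
      · exact Nat.le_mul_of_pos_left _ (by positivity)
      · push_cast
        rw [mul_pow]
        calc c / A * (A * m * (2 ^ i * r ^ i)) = c * (2 ^ i * m) * r ^ i := by
              field_simp
          _ ≤ c * (2 ^ i * m) := mul_le_of_le_one_right (by positivity) hpow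
      · calc 2 * q * (A * m * (2 * r) ^ i) ≤ 2 * r * (A * m * (2 * r) ^ i) := by gcongr
          _ = A * m * (2 * r) ^ (i + 1) := by ring
  have hbound : ∀ i : ℕ, c ≤ 2 * A * r ^ i := fun i => by
    obtain ⟨b, hb, hlt⟩ := exists_precedes_seq (hmain i 0).frequently
    have h1 := hsep 0 (b 0) (b 1)
      ((Nat.le_mul_of_pos_left _ (by positivity)).trans_eq (hb 1).2.symm) (hlt 0 1 one_pos)
    have h2 := map_sub_le_add N (0 - (b 1).foldl step 0) (0 - (b 0).foldl step 0)
    rw [sub_sub_sub_cancel_left] at h2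
    rw [(hb 1).2] at h1
    have h3 := (hb 0).1
    have h4 := (hb 1).1
    push_cast at h1
    rw [mul_pow] at h3 h4
    have h5 : c * (2 ^ i * m) ≤ 2 * A * r ^ i * (2 ^ i * m) := by linarith
    exact le_of_mul_le_mul_right h5 (by positivity)
  have hlim : Tendsto (fun i : ℕ => 2 * A * r ^ i) atTop (𝓝 (2 * A * 0)) :=
    (tendsto_pow_atTop_nhds_zero_of_lt_one hr0.le hr1).const_mul _
  have := ge_of_tendsto' hlim hbound
  linarith

end Paths

/-! ### Uniform quotient maps at large scale -/

theorem dist_le_mul_of_dist_le_natCast {X Y : Type*} [NormedAddCommGroup X] [NormedSpace ℝ X]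
    [PseudoMetricSpace Y] {f : X → Y} {L : ℝ} (hL : ∀ x x', dist x x' ≤ 1 → dist (f x) (f x') ≤ L)
    (n : ℕ) : ∀ x x', dist x x' ≤ n → dist (f x) (f x') ≤ n * L := by
  induction n with
  | zero =>
    intro x x' h
    have : x = x' := dist_le_zero.1 (by simpa using h)
    simp [this]
  | succ n ih =>
    intro x x' h
    have hn : (0 : ℝ) < n + 1 := by positivity
    push_cast at h ⊢
    let z := AffineMap.lineMap x x' ((n + 1 : ℝ)⁻¹)
    have h1 : dist x z ≤ 1 := by
      rw [dist_left_lineMap, Real.norm_of_nonneg (by positivity), inv_mul_le_iff₀ hn]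
      linarith
    have h2 : dist z x' ≤ n := by
      have h1n : 1 - (n + 1 : ℝ)⁻¹ = n / (n + 1) := by field_simp; ring
      rw [dist_lineMap_right, h1n, Real.norm_of_nonneg (by positivity), div_mul_eq_mul_div,
        div_le_iff₀ hn]
      gcongr
    have := dist_triangle (f x) (f z) (f x')
    linarith [hL _ _ h1, ih _ _ h2]

/-- Only the moduli at radius 1 matter: subdividing segments turns the upper one into a Lipschitz
bound at large distances. -/
theorem IsUniformQuotientMap.exists_coarse_bounds {X Y : Type*} [NormedAddCommGroup X]
    [NormedSpace ℝ X] [MetricSpace Y] {f : X → Y} (hf : IsUniformQuotientMap f) :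
    ∃ ω L : ℝ, 0 < ω ∧ 0 < L ∧ (∀ x x', dist (f x) (f x') ≤ L * (dist x x' + 1)) ∧
      ∀ x y, dist y (f x) ≤ ω → ∃ x', f x' = y ∧ dist x' x ≤ 1 := by
  obtain ⟨ω, Ω, -, -, hω, -, h⟩ := hf
  have hL : ∀ x x', dist x x' ≤ 1 → dist (f x) (f x') ≤ (Ω 1 : ℝ) + 1 := fun x x' hx => by
    have := (h x 1 one_pos).2 ⟨x', by simpa [dist_comm] using hx, rfl⟩
    rw [Metric.mem_closedBall'] at this
    linarith
  refine ⟨ω 1, Ω 1 + 1, by exact_mod_cast hω 1 one_pos, by positivity, fun x x' => ?_,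
    fun x y hy => ?_⟩
  · have h1 := dist_le_mul_of_dist_le_natCast hL _ x x' (Nat.le_ceil _)
    have h2 := (Nat.ceil_lt_add_one (dist_nonneg (x := x) (y := x'))).le
    refine h1.trans ?_
    rw [mul_comm]
    gcongr
  · obtain ⟨x', hx', rfl⟩ := (h x 1 one_pos).1 (Metric.mem_closedBall.2 hy)
    exact ⟨x', rfl, by simpa using hx'⟩

theorem apply_foldl_eq_add_sum {X Y : Type*} [AddCommMonoid Y] {f : X → Y} {step : X → ℕ → X}
    {v : ℕ → Y} (h : ∀ x n, f (step x n) = f x + v n) (b : List ℕ) :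
    ∀ x, f (b.foldl step x) = f x + (b.map v).sum := by
  induction b with
  | nil => simp
  | cons n b ih => intro x; simp [ih, h, add_assoc]

/-- The functional indexed by the threshold kills the earlier block and gains `θ` on each term of
the later one. -/
theorem mul_length_le_norm_sum_sub_sum {𝕜 Y : Type*} [RCLike 𝕜] [NormedAddCommGroup Y]
    [NormedSpace 𝕜 Y] {y : ℕ → Y} {φ : ℕ → StrongDual 𝕜 Y} {θ : ℝ} (hφ : ∀ n, ‖φ n‖ ≤ 1)
    (h0 : ∀ m n, m < n → φ n (y m) = 0) (h1 : ∀ m n, m ≤ n → θ ≤ RCLike.re (φ m (y n)))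
    {b b' : List ℕ} (h : b.Precedes b') : θ * b'.length ≤ ‖(b'.map y).sum - (b.map y).sum‖ := by
  obtain ⟨m, hb, hb'⟩ := h
  have hz : ∀ l : List ℕ, (∀ n ∈ l, n < m) → φ m (l.map y).sum = 0 := by
    intro l
    induction l with
    | nil => simp
    | cons n l ih =>
      intro hl
      simp [h0 n m (hl n (by simp)), ih fun k hk => hl k (by simp [hk])]
  have hp : ∀ l : List ℕ, (∀ n ∈ l, m ≤ n) → θ * l.length ≤ RCLike.re (φ m (l.map y).sum) := by
    intro l
    induction l with
    | nil => simp
    | cons n l ih =>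
      intro hl
      have h2 := h1 m n (hl n (by simp))
      have h3 := ih fun k hk => hl k (by simp [hk])
      simp only [List.length_cons, List.map_cons, List.sum_cons, map_add]
      push_cast
      linarith
  calc θ * b'.length ≤ RCLike.re (φ m ((b'.map y).sum - (b.map y).sum)) := by
        rw [map_sub, hz b hb, sub_zero]; exact hp b' hb'
    _ ≤ ‖φ m ((b'.map y).sum - (b.map y).sum)‖ := RCLike.re_le_norm _
    _ ≤ ‖φ m‖ * ‖(b'.map y).sum - (b.map y).sum‖ := (φ m).le_opNorm _
    _ ≤ ‖(b'.map y).sum - (b.map y).sum‖ := mul_le_of_le_one_left (norm_nonneg _) (hφ m)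

theorem mainTheorem3 {𝕜 𝕜' : Type*} [RCLike 𝕜] [RCLike 𝕜']
    {X : Type*} [NormedAddCommGroup X] [NormedSpace 𝕜 X] [CompleteSpace X]
    {Y : Type*} [NormedAddCommGroup Y] [NormedSpace 𝕜' Y] [CompleteSpace Y]
    (hXY : IsUniformQuotient X Y) (hX : HasEquivalentBetaNorm 𝕜 X) :
    IsReflexiveSpace 𝕜' Y := by
  by_contra hY
  obtain ⟨θ, C, y, φ, hθ, hC, hy, hφ, h0, h1⟩ := exists_seq_of_not_isReflexiveSpace hY
  obtain ⟨f, -, hf⟩ := hXY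
  obtain ⟨N, ⟨c₀, C₀, hc₀, hC₀, hN⟩, hβ⟩ := hX
  let _ : NormedSpace ℝ X := NormedSpace.restrictScalars ℝ 𝕜 X
  obtain ⟨ω, L, hω, hL, hlip, hlift⟩ := hf.exists_coarse_bounds
  let v : ℕ → Y := fun n => ((ω / C : ℝ) : 𝕜') • y n
  have hv : ∀ n, ‖v n‖ ≤ ω := fun n => by
    rw [norm_smul, RCLike.norm_ofReal, abs_of_pos (by positivity), div_mul_eq_mul_div,
      div_le_iff₀ hC]
    exact mul_le_mul_of_nonneg_left (hy n) hω.le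
  choose step hstep hdist using fun (x : X) (n : ℕ) =>
    hlift x (f x + v n) (by simpa [dist_eq_norm] using hv n)
  set κ := ω / C * θ with hκ
  have hκ0 : 0 < κ := by positivity
  -- From this length on, the additive `L` of the coarse bound is at most half of `κ * b'.length`;
  -- hence the factor `κ / (2 * L)`.
  obtain ⟨m, hm⟩ := exists_nat_ge (2 * L / κ)
  have hm0 : 0 < m := Nat.cast_pos.1 ((show 0 < 2 * L / κ by positivity).trans_le hm)
  refine hβ.not_forall_precedes_separated (step := step) (c := c₀ * (κ / (2 * L))) hC₀
    (by positivity) hm0 (fun x n => ?_) fun x b b' hb' hbb' => ?_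
  · refine (hN _).2.trans (mul_le_of_le_one_right hC₀.le ?_)
    rw [← dist_eq_norm, dist_comm]
    exact hdist x n
  · have h2 : κ * b'.length ≤ ‖(b'.map v).sum - (b.map v).sum‖ :=
      mul_length_le_norm_sum_sub_sum hφ (fun m n hmn => by simp [v, h0 m n hmn])
        (fun m n hmn => by
          rw [map_smul, smul_eq_mul, RCLike.re_ofReal_mul]
          exact mul_le_mul_of_nonneg_left (h1 m n hmn) (by positivity)) hbb'
    have h3 := hlip (b'.foldl step x) (b.foldl step x)
    rw [dist_eq_norm, apply_foldl_eq_add_sum hstep, apply_foldl_eq_add_sum hstep,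
      add_sub_add_left_eq_sub, dist_comm, dist_eq_norm] at h3
    refine le_trans ?_ (hN _).1
    rw [mul_assoc]
    refine mul_le_mul_of_nonneg_left ?_ hc₀.le
    have h4 : 2 * L / κ ≤ b'.length := hm.trans (by exact_mod_cast hb')
    rw [div_le_iff₀ hκ0] at h4
    rw [div_mul_eq_mul_div, div_le_iff₀ (by positivity)]
    linarith
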